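/- Let $\mathbb{T}=\{z\in\mathbb{C}:|z|=1\}$ and, for $a\in\mathbb{R}$, let $\|a\|=\inf_{k\in\mathbb{Z}}|a-k|$. A vector $(\varphi_1,\varphi_2)\in\mathbb{R}^2$ is called of finite type if there are constants $K>0$ and $\gamma\ge 1$ such that $\|q_1\varphi_1+q_2\varphi_2\|\ge K/\max(|q_1|,|q_2|)^{\gamma}$ for all $(q_1,q_2)\in\mathbb{Z}^2\setminus\{0\}$. Let $\arg\in(-\pi,\pi]$ denote the principal argument. Let $f_1,f_2:\mathbb{T}\to\mathbb{C}$ be real analytic functions all of whose zeros are roots of unity, and let $x_1=e^{2\pi i\varphi_1}$, $x_2=e^{2\pi i\varphi_2}$ with $(\varphi_1,\varphi_2)$ of finite type. Then $f_j(x_j^n)\neq 0$ for all $n\ge1$, and $\log|f_j(x_j^n)|=O(\log n)$ as $n\to\infty$, for $j\in\{1,2\}$. Moreover, for each of the four choices $(L_1,L_2)$ with $L_j\in\{\log|f_j|,\ \arg f_j\}$, the function $(u,v)\mapsto L_1(e^{2\pi iu})L_2(e^{2\pi iv})$ is integrable on $[0,1]^2$ and, as $n\to\infty$, $$\frac1n\sum_{m=1}^n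 L_1(x_1^m)\,L_2(x_2^m)\longrightarrow\int_{[0,1]^2}L_1(e^{2\pi iu})\,L_2(e^{2\pi iv})\,du\,dv .$$ -/

import Mathlib

open Filter Topology MeasureTheory

/-- The point `e^{2πit}` of the unit circle. -/
noncomputable def unitExp (t : ℝ) : Circle := Circle.exp (2 * Real.pi * t)

/-- A function on the unit circle is real analytic if it is real analytic in the angle. -/
def IsRealAnalyticOnCircle (f : Circle → ℂ) : Prop :=
  AnalyticOnNhd ℝ (fun t : ℝ => f (unitExp t)) Set.univ

/-- All zeros of `f` on the unit circle are roots of unity. -/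
def ZerosAreRootsOfUnity (f : Circle → ℂ) : Prop :=
  ∀ z : Circle, f z = 0 → ∃ k : ℕ, 0 < k ∧ z ^ k = 1

/-- The distance of a real number to the nearest integer. -/
noncomputable def distToInt (a : ℝ) : ℝ := ⨅ n : ℤ, |a - (n : ℝ)|

/-- A real vector `φ` is of finite type if `‖q · φ‖ ≥ K / |q|_∞ ^ γ` for all nonzero integer
vectors `q`, with constants `K > 0` and `γ ≥ 1`. Here `‖q‖` is the maximum norm of `q`. The
condition depends only on `φ` modulo integer vectors, that is, on the points `e^{2πi φ_j}`. -/
def IsFiniteType {d : ℕ} (φ : Fin d → ℝ) : Prop :=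
  ∃ K γ : ℝ, 0 < K ∧ 1 ≤ γ ∧ ∀ q : Fin d → ℤ, q ≠ 0 →
    K / ‖q‖ ^ γ ≤ distToInt (∑ j, (q j : ℝ) * φ j)

/-- The closed unit square `[0,1]²`. -/
def unitSquare : Set (ℝ × ℝ) := Set.Icc (0 : ℝ) 1 ×ˢ Set.Icc (0 : ℝ) 1

/-- For real functions `g₁, g₂` on the circle and points `x₁, x₂`, the function
`(u, v) ↦ g₁(e^{2πiu}) g₂(e^{2πiv})` is integrable on the unit square, and the averages
`(1/n) ∑_{m=1}^n g₁(x₁^m) g₂(x₂^m)` converge to its integral over the unit square. -/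
def AverageConvergesToIntegral (g₁ g₂ : Circle → ℝ) (x₁ x₂ : Circle) : Prop :=
  IntegrableOn (fun p : ℝ × ℝ => g₁ (unitExp p.1) * g₂ (unitExp p.2)) unitSquare ∧
  Tendsto (fun n : ℕ => (1 / (n : ℝ)) * ∑ m ∈ Finset.Icc 1 n, g₁ (x₁ ^ m) * g₂ (x₂ ^ m)) atTop
    (𝓝 (∫ p in unitSquare, g₁ (unitExp p.1) * g₂ (unitExp p.2)))

/-!
Put `θ_j = φ_j mod 1`, an element of the circle group `ℝ / ℤ`. Finite type makes `θ₁, θ₂` linearly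
independent over `ℤ`, so by Weyl's criterion the empirical measures of `m (θ₁, θ₂)`, `1 ≤ m ≤ n`,
converge weakly to Lebesgue measure on the torus. The functions `log |f_j|` and `arg f_j` are
continuous off finitely many points, so only the unboundedness of the logarithms stands between
weak convergence and the claim, and a bound for the second moments of the products along the orbit
gives the uniform integrability needed to overcome it.

By analyticity `|log |f_j||` is at most a constant times `1 + ∑ log⁺ (1 / |z - a|)`, summed over the
zeros `a`. If `a` has finite order, the Diophantine condition on `θ_j` is inherited by the distances
`‖m θ_j - a‖`: they are at least `K / m ^ γ`, whence the nonvanishing and the `O(log n)` bound, and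
two of them can be small only for indices that are far apart, whence a pigeonhole argument bounds
their sums of small negative powers, and so all moments of `log⁺ (1 / ‖m θ_j - a‖)`, by `O(n)`.
-/

section WeakConvergence

open scoped ENNReal

theorem closure_preimage_subset_of_isClosed {X Y : Type*} [TopologicalSpace X] [TopologicalSpace Y]
    (f : X → Y) {s : Set Y} (hs : IsClosed s) :
    closure (f ⁻¹' s) ⊆ f ⁻¹' s ∪ {x | ¬ContinuousAt f x} := by
  intro x hx
  by_cases hfx : ContinuousAt f x
  · exact .inl (closure_minimal (Set.image_preimage_subset f s) hs
      (mem_closure_image hfx hx))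
  · exact .inr hfx

theorem tendsto_map_of_ae_continuousAt {X Y ι : Type*} [TopologicalSpace X] [MeasurableSpace X]
    [OpensMeasurableSpace X] [HasOuterApproxClosed X] [TopologicalSpace Y] [MeasurableSpace Y]
    [OpensMeasurableSpace Y] {l : Filter ι} [l.IsCountablyGenerated] {μ : ProbabilityMeasure X}
    {μs : ι → ProbabilityMeasure X} (hμ : Tendsto μs l (𝓝 μ)) {f : X → Y} (hf : Measurable f)
    (hfc : ∀ᵐ x ∂(μ : Measure X), ContinuousAt f x) :
    Tendsto (fun i => (μs i).map hf.aemeasurable) l (𝓝 (μ.map hf.aemeasurable)) := by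
  refine tendsto_of_forall_isClosed_limsup_le' fun s hs => ?_
  simp only [ProbabilityMeasure.toMeasure_map, Measure.map_apply hf hs.measurableSet]
  calc limsup (fun i => (μs i : Measure X) (f ⁻¹' s)) l
      ≤ limsup (fun i => (μs i : Measure X) (closure (f ⁻¹' s))) l :=
        limsup_le_limsup (.of_forall fun i => measure_mono subset_closure)
    _ ≤ (μ : Measure X) (closure (f ⁻¹' s)) :=
        ProbabilityMeasure.limsup_measure_closed_le_of_tendsto hμ isClosed_closure
    _ ≤ (μ : Measure X) (f ⁻¹' s) + (μ : Measure X) {x | ¬ContinuousAt f x} :=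
        (measure_mono (closure_preimage_subset_of_isClosed f hs)).trans (measure_union_le _ _)
    _ = (μ : Measure X) (f ⁻¹' s) := by rw [ae_iff.mp hfc, add_zero]

theorem integrable_and_integral_le_of_tendsto {X : Type*} [TopologicalSpace X] [MeasurableSpace X]
    [OpensMeasurableSpace X] [HasOuterApproxClosed X] {μ : ProbabilityMeasure X}
    {μs : ℕ → ProbabilityMeasure X} (hμ : Tendsto μs atTop (𝓝 μ)) {f : X → ℝ} (hf : Continuous f)
    (hf0 : 0 ≤ f) {C : ℝ} (hfi : ∀ n, Integrable f (μs n)) (hfC : ∀ n, ∫ x, f x ∂(μs n) ≤ C) :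
    Integrable f μ ∧ ∫ x, f x ∂μ ≤ C := by
  have hC : 0 ≤ C := (integral_nonneg hf0).trans (hfC 0)
  have hle : ∫⁻ x, ENNReal.ofReal (f x) ∂μ ≤ ENNReal.ofReal C := by
    refine (lintegral_le_liminf_lintegral_of_forall_isOpen_measure_le_liminf_measure hf hf0
      fun G hG => ProbabilityMeasure.le_liminf_measure_open_of_tendsto hμ hG).trans
      (liminf_le_of_frequently_le' (.of_forall fun n => ?_))
    rw [← ofReal_integral_eq_lintegral_ofReal (hfi n) (.of_forall hf0)]
    exact ENNReal.ofReal_le_ofReal (hfC n)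
  have hint : Integrable f μ := ⟨hf.aestronglyMeasurable, by
    rw [hasFiniteIntegral_iff_ofReal (.of_forall hf0)]
    exact hle.trans_lt ENNReal.ofReal_lt_top⟩
  rw [← ofReal_integral_eq_lintegral_ofReal hint (.of_forall hf0)] at hle
  exact ⟨hint, (ENNReal.ofReal_le_ofReal_iff hC).mp hle⟩

theorem abs_sub_max_min_le {R : ℝ} (hR : 0 < R) (x : ℝ) : |x - max (-R) (min R x)| ≤ x ^ 2 / R := by
  rw [le_div_iff₀ hR, ← sq_abs, sq]
  rcases le_total |x| R with h | h
  · obtain ⟨hx, hx'⟩ := abs_le.mp h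
    rw [min_eq_right hx', max_eq_right hx, sub_self, abs_zero, zero_mul]
    positivity
  · exact mul_le_mul (by grind) h hR.le (abs_nonneg x)

theorem abs_integral_sub_integral_max_min_le {X : Type*} [MeasurableSpace X] {μ : Measure X}
    [IsFiniteMeasure μ] {f : X → ℝ} (hf : MemLp f 2 μ) {R : ℝ} (hR : 0 < R) :
    |∫ x, f x ∂μ - ∫ x, max (-R) (min R (f x)) ∂μ| ≤ (∫ x, f x ^ 2 ∂μ) / R := by
  have hfi : Integrable f μ := hf.integrable one_le_two
  have hgi : Integrable (fun x => max (-R) (min R (f x))) μ :=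
    (integrable_const (-R)).sup ((integrable_const R).inf hfi)
  rw [← integral_sub hfi hgi, ← integral_div]
  refine (abs_integral_le_integral_abs).trans (integral_mono (hfi.sub hgi).abs
    (hf.integrable_sq.div_const R) fun x => abs_sub_max_min_le hR (f x))

theorem integrable_and_tendsto_integral_of_integral_sq_le {X : Type*} [TopologicalSpace X]
    [MeasurableSpace X] [OpensMeasurableSpace X] [HasOuterApproxClosed X] {μ : ProbabilityMeasure X}
    {μs : ℕ → ProbabilityMeasure X} (hμ : Tendsto μs atTop (𝓝 μ)) {f : X → ℝ} (hf : Continuous f)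
    {C : ℝ} (hfL : ∀ n, MemLp f 2 (μs n)) (hfC : ∀ n, ∫ x, f x ^ 2 ∂(μs n) ≤ C) :
    Integrable f μ ∧ Tendsto (fun n => ∫ x, f x ∂(μs n)) atTop (𝓝 (∫ x, f x ∂μ)) := by
  obtain ⟨hi, hC⟩ := integrable_and_integral_le_of_tendsto hμ (hf.pow 2)
    (fun x => sq_nonneg (f x)) (fun n => (hfL n).integrable_sq) hfC
  have hL : MemLp f 2 (μ : Measure X) :=
    (memLp_two_iff_integrable_sq hf.aestronglyMeasurable).mpr hi
  refine ⟨hL.integrable one_le_two, Metric.tendsto_atTop'.mpr fun ε hε => ?_⟩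
  have hC0 : 0 ≤ C := (integral_nonneg fun x => sq_nonneg (f x)).trans hC
  obtain ⟨R, hR⟩ : ∃ R : ℝ, 3 * C / ε < R := exists_gt _
  have hR0 : 0 < R := (by positivity : 0 ≤ 3 * C / ε).trans_lt hR
  have hCR : C / R < ε / 3 := by
    rw [div_lt_div_iff₀ hR0 three_pos]; rw [div_lt_iff₀ hε] at hR; linarith
  have htrunc : Tendsto (fun n => ∫ x, max (-R) (min R (f x)) ∂(μs n)) atTop
      (𝓝 (∫ x, max (-R) (min R (f x)) ∂μ)) :=
    ProbabilityMeasure.tendsto_iff_forall_integral_tendsto.mp hμ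
      (.ofNormedAddCommGroup (fun x => max (-R) (min R (f x))) (by fun_prop) R fun x =>
        abs_le.mpr ⟨le_max_left _ _, max_le (by linarith) (min_le_left _ _)⟩)
  obtain ⟨N, hN⟩ := Metric.tendsto_atTop.mp htrunc (ε / 3) (by positivity)
  refine ⟨N, fun n hn => ?_⟩
  have hn1 := (abs_integral_sub_integral_max_min_le (hfL n) hR0).trans
    (div_le_div_of_nonneg_right (hfC n) hR0.le)
  have hn2 := (abs_integral_sub_integral_max_min_le hL hR0).trans
    (div_le_div_of_nonneg_right hC hR0.le)
  have hn3 := hN n hn.le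
  rw [Real.dist_eq] at hn3 ⊢
  rw [abs_le] at hn1 hn2
  rw [abs_lt] at hn3 ⊢
  constructor <;> linarith [hn1.1, hn1.2, hn2.1, hn2.2, hn3.1, hn3.2]

/-- The empirical measure `(1 / (n + 1)) ∑_{m=1}^{n+1} δ_{x m}` of a sequence `x`. The index is
shifted so that every value is a probability measure. -/
noncomputable def empiricalMeasure {X : Type*} [MeasurableSpace X] (x : ℕ → X) (n : ℕ) :
    ProbabilityMeasure X :=
  ⟨(n + 1 : ℝ≥0∞)⁻¹ • ∑ m ∈ Finset.Icc 1 (n + 1), Measure.dirac (x m), ⟨by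
    simp only [Measure.smul_apply, Measure.coe_finsetSum, Finset.sum_apply, measure_univ,
      Finset.sum_const, Nat.card_Icc, add_tsub_cancel_right, nsmul_eq_mul, mul_one, smul_eq_mul,
      Nat.cast_add, Nat.cast_one]
    exact ENNReal.inv_mul_cancel (by simp) (by simp)⟩⟩

theorem toMeasure_empiricalMeasure {X : Type*} [MeasurableSpace X] (x : ℕ → X) (n : ℕ) :
    (empiricalMeasure x n : Measure X) =
      (n + 1 : ℝ≥0∞)⁻¹ • ∑ m ∈ Finset.Icc 1 (n + 1), Measure.dirac (x m) :=
  rfl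

theorem map_empiricalMeasure {X Y : Type*} [MeasurableSpace X] [MeasurableSpace Y] (x : ℕ → X)
    {f : X → Y} (hf : Measurable f) (n : ℕ) :
    (empiricalMeasure x n).map hf.aemeasurable = empiricalMeasure (fun m => f (x m)) n := by
  refine Subtype.ext ?_
  rw [ProbabilityMeasure.val_eq_to_measure, ProbabilityMeasure.toMeasure_map]
  simp only [toMeasure_empiricalMeasure, Measure.map_smul,
    Measure.map_finset_sum hf.aemeasurable, Measure.map_dirac' hf]
  rfl

theorem integrable_empiricalMeasure {X E : Type*} [MeasurableSpace X] [MeasurableSingletonClass X]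
    [NormedAddCommGroup E] (x : ℕ → X) (f : X → E) (n : ℕ) :
    Integrable f (empiricalMeasure x n : Measure X) :=
  (integrable_finsetSum_measure.mpr fun _ _ => integrable_dirac (by simp)).smul_measure (by simp)

theorem integral_empiricalMeasure {X E : Type*} [MeasurableSpace X] [MeasurableSingletonClass X]
    [NormedAddCommGroup E] [NormedSpace ℝ E] [CompleteSpace E] (x : ℕ → X) (f : X → E) (n : ℕ) :
    ∫ y, f y ∂(empiricalMeasure x n : Measure X) =
      (n + 1 : ℝ)⁻¹ • ∑ m ∈ Finset.Icc 1 (n + 1), f (x m) := by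
  rw [toMeasure_empiricalMeasure, integral_smul_measure,
    integral_finsetSum_measure fun _ _ => integrable_dirac (by simp)]
  simp only [integral_dirac]
  rw [ENNReal.toReal_inv, ENNReal.toReal_add (by simp) (by simp), ENNReal.toReal_natCast,
    ENNReal.toReal_one]

theorem integrable_and_tendsto_average_of_tendsto_empiricalMeasure {X : Type*} [TopologicalSpace X]
    [MeasurableSpace X] [OpensMeasurableSpace X] [HasOuterApproxClosed X] {μ : ProbabilityMeasure X}
    {x : ℕ → X} (hx : Tendsto (empiricalMeasure x) atTop (𝓝 μ)) {f : X → ℝ} (hf : Measurable f)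
    (hfc : ∀ᵐ y ∂(μ : Measure X), ContinuousAt f y) {C : ℝ}
    (hC : ∀ n : ℕ, ∑ m ∈ Finset.Icc 1 n, f (x m) ^ 2 ≤ C * n) :
    Integrable f μ ∧
      Tendsto (fun n : ℕ => (n : ℝ)⁻¹ * ∑ m ∈ Finset.Icc 1 n, f (x m)) atTop
        (𝓝 (∫ y, f y ∂μ)) := by
  have hmap := tendsto_map_of_ae_continuousAt hx hf hfc
  simp only [map_empiricalMeasure x hf] at hmap
  obtain ⟨hint, hlim⟩ := integrable_and_tendsto_integral_of_integral_sq_le hmap continuous_id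
    (C := C) (fun n => (memLp_two_iff_integrable_sq continuous_id.aestronglyMeasurable).mpr
      (integrable_empiricalMeasure _ _ n)) fun n => by
        rw [integral_empiricalMeasure, smul_eq_mul, inv_mul_le_iff₀ (by positivity), mul_comm]
        exact_mod_cast hC (n + 1)
  rw [ProbabilityMeasure.toMeasure_map] at hint hlim
  refine ⟨(integrable_map_measure continuous_id.aestronglyMeasurable hf.aemeasurable).mp hint,
    (tendsto_add_atTop_iff_nat 1).mp ?_⟩
  rw [integral_map hf.aemeasurable continuous_id.aestronglyMeasurable] at hlim
  simpa only [integral_empiricalMeasure, smul_eq_mul, Nat.cast_add, Nat.cast_one, id] using hlim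

end WeakConvergence

section WeylCriterion

theorem tendsto_of_span_topologicalClosure_eq_top {X ι : Type*} [TopologicalSpace X]
    [CompactSpace X] [MeasurableSpace X] [OpensMeasurableSpace X] {l : Filter ι}
    {μ : ProbabilityMeasure X} {μs : ι → ProbabilityMeasure X} {S : Set C(X, ℂ)}
    (hS : (Submodule.span ℂ S).topologicalClosure = ⊤)
    (h : ∀ f ∈ S, Tendsto (fun i => ∫ x, f x ∂(μs i)) l (𝓝 (∫ x, f x ∂μ))) :
    Tendsto μs l (𝓝 μ) := by
  have hint (ν : ProbabilityMeasure X) (f : C(X, ℂ)) : Integrable f (ν : Measure X) :=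
    (BoundedContinuousFunction.mkOfCompact f).integrable _
  have hlip (ν : ProbabilityMeasure X) : LipschitzWith 1 fun f : C(X, ℂ) => ∫ x, f x ∂ν :=
    .of_dist_le_mul fun f g => by
      rw [NNReal.coe_one, one_mul, dist_eq_norm, dist_eq_norm, ← integral_sub (hint ν f) (hint ν g)]
      exact (norm_integral_le_of_norm_le_const (.of_forall (f - g).norm_coe_le_norm)).trans_eq
        (by rw [probReal_univ, mul_one])
  have hclosed : IsClosed {f : C(X, ℂ) |
      Tendsto (fun i => ∫ x, f x ∂(μs i)) l (𝓝 (∫ x, f x ∂μ))} :=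
    (LipschitzWith.uniformEquicontinuous _ 1 fun i => hlip (μs i)).equicontinuous
      |>.isClosed_setOfPred_tendsto (hlip μ).continuous
  have hspan : ∀ f ∈ Submodule.span ℂ S,
      Tendsto (fun i => ∫ x, f x ∂(μs i)) l (𝓝 (∫ x, f x ∂μ)) := fun f hf => by
    induction hf using Submodule.span_induction with
    | mem f hf => exact h f hf
    | zero => simp only [ContinuousMap.zero_apply, integral_zero, tendsto_const_nhds]
    | add f g _ _ hf hg =>
      simpa only [ContinuousMap.add_apply, integral_add (hint _ f) (hint _ g)] using hf.add hg
    | smul c f _ hf =>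
      simpa only [ContinuousMap.smul_apply, integral_smul] using hf.const_smul c
  refine (ProbabilityMeasure.tendsto_iff_forall_integral_rclike_tendsto ℂ).mpr fun f => ?_
  have hf : f.toContinuousMap ∈ (Submodule.span ℂ S).topologicalClosure := hS ▸ Submodule.mem_top
  exact closure_minimal hspan hclosed hf

instance isProbabilityMeasure_volume_unitAddCircle :
    IsProbabilityMeasure (volume : Measure UnitAddCircle) :=
  ⟨UnitAddCircle.measure_univ⟩

theorem norm_sum_Icc_pow_le {w : ℂ} (hw : ‖w‖ ≤ 1) (hw1 : w ≠ 1) (n : ℕ) :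
    ‖∑ m ∈ Finset.Icc 1 n, w ^ m‖ ≤ 2 / ‖w - 1‖ := by
  have hpow : ‖w ^ (n + 1) - w‖ ≤ 2 := by
    refine (norm_sub_le _ _).trans ?_
    rw [norm_pow]
    linarith [pow_le_one₀ (n := n + 1) (norm_nonneg w) hw]
  rw [← Finset.Ico_add_one_right_eq_Icc, geom_sum_Ico hw1 (by lia), pow_one, norm_div]
  gcongr

theorem mFourier_eq_toCircle {ι : Type*} [Fintype ι] (q : ι → ℤ) (z : UnitAddTorus ι) :
    UnitAddTorus.mFourier q z = AddCircle.toCircle (∑ i, q i • z i) := by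
  have hsum (s : Finset ι) : (AddCircle.toCircle (∑ i ∈ s, q i • z i) : ℂ) =
      ∏ i ∈ s, fourier (q i) (z i) := by
    classical
    induction s using Finset.induction_on with
    | empty => simp
    | insert i s hi ih =>
      rw [Finset.sum_insert hi, Finset.prod_insert hi, AddCircle.toCircle_add, Circle.coe_mul, ih,
        fourier_apply]
  exact (hsum Finset.univ).symm

theorem integral_mFourier_eq_zero {ι : Type*} [Fintype ι] {q : ι → ℤ} (hq : q ≠ 0) :
    ∫ z, UnitAddTorus.mFourier q z = 0 := by
  obtain ⟨i, hi⟩ := Function.ne_iff.mp hq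
  change ∫ z : UnitAddTorus ι, ∏ j, fourier (q j) (z j) = 0
  rw [integral_fintype_prod_volume_eq_prod]
  exact Finset.prod_eq_zero (Finset.mem_univ i)
    (integral_eq_zero_of_add_right_eq_neg (fourier_add_half_inv_index hi one_pos))

theorem tendsto_empiricalMeasure_nsmul {ι : Type*} [Fintype ι] {θ : UnitAddTorus ι}
    (hθ : LinearIndependent ℤ θ) :
    Tendsto (empiricalMeasure fun m => m • θ) atTop (𝓝 ⟨volume, inferInstance⟩) := by
  refine tendsto_of_span_topologicalClosure_eq_top UnitAddTorus.span_mFourier_closure_eq_top ?_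
  rintro _ ⟨q, rfl⟩
  rcases eq_or_ne q 0 with rfl | hq
  · simp only [UnitAddTorus.mFourier_zero, ContinuousMap.one_apply, integral_const,
      ProbabilityMeasure.coe_mk, probReal_univ, tendsto_const_nhds]
  have hw : UnitAddTorus.mFourier q θ ≠ 1 := by
    rw [mFourier_eq_toCircle, Ne, Circle.coe_eq_one, ← AddCircle.toCircle_zero (T := 1),
      (AddCircle.injective_toCircle one_ne_zero).eq_iff]
    exact fun h => hq (funext (Fintype.linearIndependent_iff.mp hθ q h))
  have hpow (m : ℕ) : UnitAddTorus.mFourier q (m • θ) = UnitAddTorus.mFourier q θ ^ m := by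
    simp only [mFourier_eq_toCircle, Pi.smul_apply, smul_comm _ m, ← Finset.smul_sum,
      AddCircle.toCircle_nsmul, Circle.coe_pow]
  have hbound (n : ℕ) : ‖∫ z, UnitAddTorus.mFourier q z ∂(empiricalMeasure (fun m => m • θ) n)‖ ≤
      2 / ‖UnitAddTorus.mFourier q θ - 1‖ * (1 / ((n : ℝ) + 1)) := by
    rw [integral_empiricalMeasure, norm_smul, Real.norm_of_nonneg (by positivity), mul_comm,
      inv_eq_one_div]
    simp only [hpow]
    gcongr
    exact norm_sum_Icc_pow_le ((UnitAddTorus.mFourier q).norm_coe_le_norm θ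
      |>.trans_eq UnitAddTorus.mFourier_norm) hw _
  rw [ProbabilityMeasure.coe_mk, integral_mFourier_eq_zero hq]
  refine squeeze_zero_norm hbound ?_
  simpa only [mul_zero] using tendsto_one_div_add_atTop_nhds_zero_nat.const_mul
    (2 / ‖UnitAddTorus.mFourier q θ - 1‖)

end WeylCriterion

section Diophantine

theorem exists_lt_sub_mul_le {n : ℕ} {S : Finset ℕ} (hS : S ⊆ Finset.Icc 1 n)
    (hcard : 2 ≤ S.card) : ∃ a ∈ S, ∃ b ∈ S, a < b ∧ (b - a) * (S.card - 1) ≤ n := by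
  have hn : 0 < n := by
    obtain ⟨a, ha⟩ := Finset.card_pos.1 (by lia : 0 < S.card)
    have := Finset.mem_Icc.1 (hS ha)
    lia
  -- Pigeonhole: `S` has more elements than there are subintervals of length `n / (#S - 1)`.
  obtain ⟨a, ha, b, hb, hab, hdiv⟩ := Finset.exists_ne_map_eq_of_card_lt_of_maps_to
    (s := S) (t := Finset.range (S.card - 1)) (f := fun m => (m - 1) * (S.card - 1) / n)
    (by rw [Finset.card_range]; lia) (fun m hm => by
      have := Finset.mem_Icc.1 (hS hm)
      rw [Finset.coe_range, Set.mem_Iio, Nat.div_lt_iff_lt_mul hn, mul_comm (S.card - 1) n]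
      exact Nat.mul_lt_mul_of_pos_right (by lia) (by lia))
  wlog hlt : a < b generalizing a b
  · exact this b hb a ha hab.symm hdiv.symm (by lia)
  have hsub : (b - 1) * (S.card - 1) = (b - a) * (S.card - 1) + (a - 1) * (S.card - 1) := by
    have := Finset.mem_Icc.1 (hS ha)
    rw [← add_mul]
    congr 1
    lia
  have hmoda := Nat.div_add_mod ((a - 1) * (S.card - 1)) n
  have hmodb := Nat.div_add_mod ((b - 1) * (S.card - 1)) n
  have hmod := Nat.mod_lt ((b - 1) * (S.card - 1)) hn
  rw [hdiv] at hmoda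
  exact ⟨a, ha, b, hb, hlt, by lia⟩

theorem sum_le_sum_of_forall_subset_exists_le {ι : Type*} {w : ι → ℝ} {B : ℕ → ℝ} (T : Finset ι)
    (h : ∀ S ⊆ T, S.Nonempty → ∃ m ∈ S, w m ≤ B S.card) :
    ∑ m ∈ T, w m ≤ ∑ j ∈ Finset.Icc 1 T.card, B j := by
  classical
  induction T using Finset.strongInduction with
  | H T ih =>
    rcases T.eq_empty_or_nonempty with rfl | hT
    · simp
    · obtain ⟨m, hm, hw⟩ := h T subset_rfl hT
      have herase := ih (T.erase m) (Finset.erase_ssubset hm)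
        fun S hS => h S (hS.trans (Finset.erase_subset _ _))
      have hcard : (T.erase m).card + 1 = T.card := Finset.card_erase_add_one hm
      rw [← Finset.sum_erase_add _ _ hm, ← hcard, Finset.sum_Icc_succ_top (by lia), hcard]
      exact add_le_add herase hw

theorem sum_one_div_sqrt_le (n : ℕ) : ∑ j ∈ Finset.Icc 1 n, 1 / √(j : ℝ) ≤ 2 * √n := by
  induction n with
  | zero => simp
  | succ n ih =>
    have hpos : 0 < √((n + 1 : ℕ) : ℝ) := by positivity
    have hn1 : √((n + 1 : ℕ) : ℝ) ^ 2 = n + 1 := by rw [Real.sq_sqrt (by positivity)]; simp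
    have hn : √(n : ℝ) ^ 2 = n := Real.sq_sqrt (by positivity)
    have hstep : 1 / √((n + 1 : ℕ) : ℝ) ≤ 2 * √((n + 1 : ℕ) : ℝ) - 2 * √(n : ℝ) := by
      rw [div_le_iff₀ hpos]
      nlinarith [sq_nonneg (√((n + 1 : ℕ) : ℝ) - √(n : ℝ))]
    rw [Finset.sum_Icc_succ_top (by lia)]
    linarith

theorem sum_sqrt_div_le (n : ℕ) : ∑ j ∈ Finset.Icc 1 n, √((n : ℝ) / j) ≤ 2 * n :=
  calc ∑ j ∈ Finset.Icc 1 n, √((n : ℝ) / j) = √n * ∑ j ∈ Finset.Icc 1 n, 1 / √(j : ℝ) := by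
        simp only [Finset.mul_sum, mul_one_div, Real.sqrt_div n.cast_nonneg]
    _ ≤ √n * (2 * √n) := by gcongr; exact sum_one_div_sqrt_le n
    _ = 2 * n := by rw [mul_left_comm, Real.mul_self_sqrt n.cast_nonneg]

/-- The multiples `n • θ`, `n ≥ 1`, approach `a` at most polynomially fast in `n`. For `a = 0` this
is the usual Diophantine condition on `θ`; a nonzero `a` makes it inhomogeneous. -/
def IsDiophantine {A : Type*} [SeminormedAddCommGroup A] (θ a : A) : Prop :=
  ∃ K γ : ℝ, 0 < K ∧ ∀ n : ℕ, 1 ≤ n → K / (n : ℝ) ^ γ ≤ ‖n • θ - a‖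

variable {A : Type*} [SeminormedAddCommGroup A] {θ a : A}

theorem isDiophantine_of_nsmul_eq_zero (hθ : IsDiophantine θ 0) {k : ℕ} (hk : 0 < k)
    (ha : k • a = 0) : IsDiophantine θ a := by
  obtain ⟨K, γ, hK, hθ⟩ := hθ
  have hk0 : (0 : ℝ) < k := Nat.cast_pos.mpr hk
  refine ⟨K / k ^ γ / k, γ, by positivity, fun n hn => ?_⟩
  have hle := (hθ (k * n) (Nat.mul_pos hk hn)).trans_eq (b := ‖(k * n) • θ - 0‖)
    (c := ‖k • (n • θ - a)‖) (by rw [nsmul_sub, ha, mul_nsmul'])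
  calc K / k ^ γ / k / n ^ γ = K / ((k * n : ℕ) : ℝ) ^ γ / k := by
        rw [Nat.cast_mul, Real.mul_rpow hk0.le n.cast_nonneg, div_right_comm, div_div K]
    _ ≤ k * ‖n • θ - a‖ / k := by gcongr; exact hle.trans norm_nsmul_le
    _ = ‖n • θ - a‖ := mul_div_cancel_left₀ _ hk0.ne'

theorem IsDiophantine.exists_common_bound {b : A} (ha : IsDiophantine θ a)
    (hb : IsDiophantine θ b) : ∃ K γ : ℝ, 0 < K ∧ 0 < γ ∧ ∀ n : ℕ, 1 ≤ n →
      K / (n : ℝ) ^ γ ≤ ‖n • θ - a‖ ∧ K / (n : ℝ) ^ γ ≤ ‖n • θ - b‖ := by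
  obtain ⟨K, γ, hK, ha⟩ := ha
  obtain ⟨L, δ, hL, hb⟩ := hb
  refine ⟨min K L, max 1 (max γ δ), lt_min hK hL, by positivity, fun n hn => ?_⟩
  have hn1 : (1 : ℝ) ≤ n := Nat.one_le_cast.mpr hn
  constructor
  · refine le_trans ?_ (ha n hn)
    gcongr
    · exact min_le_left _ _
    · exact (le_max_left _ _).trans (le_max_right _ _)
  · refine le_trans ?_ (hb n hn)
    gcongr
    · exact min_le_right _ _
    · exact (le_max_right _ _).trans (le_max_right _ _)

theorem mul_div_rpow_le {K γ : ℝ} (hK : 0 ≤ K) (hγ : 0 ≤ γ) {k d n : ℕ} (hd : 0 < d) (hn : 0 < n)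
    (h : k * d ≤ 2 * n) : K / 2 / 2 ^ γ * (k / n : ℝ) ^ γ ≤ K / d ^ γ / 2 := by
  have hd0 : (0 : ℝ) < d := Nat.cast_pos.mpr hd
  calc K / 2 / 2 ^ γ * (k / n : ℝ) ^ γ ≤ K / 2 / 2 ^ γ * (2 / d : ℝ) ^ γ := by
        gcongr K / 2 / 2 ^ γ * ?_ ^ γ
        rw [div_le_div_iff₀ (Nat.cast_pos.mpr hn) hd0]
        exact_mod_cast h
    _ = K / d ^ γ / 2 := by
        rw [Real.div_rpow zero_le_two hd0.le]
        field_simp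

theorem IsDiophantine.exists_mul_card_div_rpow_le (hθ : IsDiophantine θ 0)
    (hθa : IsDiophantine θ a) : ∃ c γ : ℝ, 0 < c ∧ 0 < γ ∧
      ∀ (n : ℕ) (S : Finset ℕ), S ⊆ Finset.Icc 1 n → S.Nonempty →
        ∃ m ∈ S, c * (S.card / n : ℝ) ^ γ ≤ ‖m • θ - a‖ := by
  obtain ⟨K, γ, hK, hγ, hθ⟩ := hθ.exists_common_bound hθa
  refine ⟨K / 2 / 2 ^ γ, γ, by positivity, hγ, fun n S hS hne => ?_⟩
  have hn : 0 < n := by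
    obtain ⟨m, hm⟩ := hne
    have := Finset.mem_Icc.mp (hS hm)
    lia
  rcases Nat.lt_or_ge S.card 2 with hcard | hcard
  · obtain ⟨m, hm⟩ := hne
    obtain ⟨hm1, hmn⟩ := Finset.mem_Icc.mp (hS hm)
    have hpos : 0 ≤ K / (m : ℝ) ^ γ := by positivity
    refine ⟨m, hm, (mul_div_rpow_le hK.le hγ.le hm1 hn (by nlinarith)).trans ?_⟩
    linarith [(hθ m hm1).2]
  · -- Multiples of `θ` whose indices differ by little cannot both be close to `a`.
    obtain ⟨u, hu, v, hv, huv, hgap⟩ := exists_lt_sub_mul_le hS hcard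
    have hd : S.card * (v - u) ≤ 2 * n := by
      have : S.card ≤ 2 * (S.card - 1) := by lia
      calc S.card * (v - u) ≤ 2 * (S.card - 1) * (v - u) := Nat.mul_le_mul_right _ this
        _ = 2 * ((v - u) * (S.card - 1)) := by ring
        _ ≤ 2 * n := Nat.mul_le_mul_left _ hgap
    have hsep : K / ((v - u : ℕ) : ℝ) ^ γ ≤ ‖v • θ - a‖ + ‖u • θ - a‖ :=
      calc K / ((v - u : ℕ) : ℝ) ^ γ ≤ ‖(v - u) • θ - 0‖ := (hθ (v - u) (by lia)).1
        _ = ‖(v • θ - a) - (u • θ - a)‖ := by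
            rw [sub_zero, sub_sub_sub_cancel_right, sub_nsmul θ huv.le, sub_eq_add_neg]
        _ ≤ ‖v • θ - a‖ + ‖u • θ - a‖ := norm_sub_le _ _
    have hle := mul_div_rpow_le hK.le hγ.le (by lia) hn hd
    rcases le_total ‖u • θ - a‖ ‖v • θ - a‖ with h | h
    · exact ⟨v, hv, by linarith⟩
    · exact ⟨u, hu, by linarith⟩

theorem IsDiophantine.exists_sum_inv_norm_rpow_le (hθ : IsDiophantine θ 0)
    (hθa : IsDiophantine θ a) : ∃ s C : ℝ, 0 < s ∧
      ∀ n : ℕ, ∑ m ∈ Finset.Icc 1 n, ‖m • θ - a‖⁻¹ ^ s ≤ C * n := by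
  obtain ⟨c, γ, hc, hγ, h⟩ := hθ.exists_mul_card_div_rpow_le hθa
  refine ⟨(2 * γ)⁻¹, (c⁻¹ ^ (2 * γ)⁻¹) * 2, by positivity, fun n => ?_⟩
  calc ∑ m ∈ Finset.Icc 1 n, ‖m • θ - a‖⁻¹ ^ (2 * γ)⁻¹
      ≤ ∑ j ∈ Finset.Icc 1 n, c⁻¹ ^ (2 * γ)⁻¹ * √(n / j) := by
        refine (sum_le_sum_of_forall_subset_exists_le (B := fun j => c⁻¹ ^ (2 * γ)⁻¹ * √(n / j))
          (Finset.Icc 1 n) fun S hS hne => ?_).trans_eq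
            (by rw [Nat.card_Icc, add_tsub_cancel_right])
        obtain ⟨m, hm, hle⟩ := h n S hS hne
        have hn0 : (0 : ℝ) < n := Nat.cast_pos.mpr (by
          have := Finset.mem_Icc.mp (hS hm); lia)
        have : (0 : ℝ) < S.card := Nat.cast_pos.mpr hne.card_pos
        refine ⟨m, hm, ?_⟩
        calc ‖m • θ - a‖⁻¹ ^ (2 * γ)⁻¹ ≤ (c * (S.card / n) ^ γ)⁻¹ ^ (2 * γ)⁻¹ := by gcongr
          _ = c⁻¹ ^ (2 * γ)⁻¹ * ((n / S.card : ℝ) ^ γ) ^ (2 * γ)⁻¹ := by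
            rw [mul_inv, Real.mul_rpow (by positivity) (by positivity),
              ← Real.inv_rpow (by positivity), inv_div]
          _ = c⁻¹ ^ (2 * γ)⁻¹ * √(n / S.card) := by
            rw [← Real.rpow_mul (by positivity), Real.sqrt_eq_rpow]
            congr 2
            field_simp
    _ ≤ c⁻¹ ^ (2 * γ)⁻¹ * (2 * n) := by
        rw [← Finset.mul_sum]
        gcongr
        exact sum_sqrt_div_le n
    _ = c⁻¹ ^ (2 * γ)⁻¹ * 2 * n := (mul_assoc _ _ _).symm

theorem IsDiophantine.nsmul_sub_ne_zero (h : IsDiophantine θ a) {n : ℕ} (hn : 1 ≤ n) :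
    n • θ - a ≠ 0 := by
  obtain ⟨K, γ, hK, h⟩ := h
  intro h0
  have hle := h n hn
  have hn0 : (0 : ℝ) < n := Nat.cast_pos.mpr hn
  rw [h0, norm_zero] at hle
  exact hle.not_gt (by positivity)

theorem IsDiophantine.isBigO_posLog_inv_norm (h : IsDiophantine θ a) :
    (fun n : ℕ => Real.posLog ‖n • θ - a‖⁻¹) =O[atTop] fun n : ℕ => Real.log n := by
  obtain ⟨K, γ, hK, h⟩ := h
  have hle : (fun n : ℕ => Real.posLog ‖n • θ - a‖⁻¹) =O[atTop]
      fun n : ℕ => Real.posLog K⁻¹ + |γ| * Real.log n := by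
    refine .of_norm_eventuallyLE ?_
    filter_upwards [eventually_ge_atTop 1] with n hn
    have hn1 : (1 : ℝ) ≤ n := Nat.one_le_cast.mpr hn
    have hinv : ‖n • θ - a‖⁻¹ ≤ K⁻¹ * (n : ℝ) ^ |γ| :=
      calc ‖n • θ - a‖⁻¹ ≤ (K / (n : ℝ) ^ γ)⁻¹ := by gcongr; exact h n hn
        _ = K⁻¹ * (n : ℝ) ^ γ := by rw [inv_div, div_eq_inv_mul]
        _ ≤ K⁻¹ * (n : ℝ) ^ |γ| := by gcongr; exact le_abs_self γ
    rw [Real.norm_of_nonneg Real.posLog_nonneg]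
    calc Real.posLog ‖n • θ - a‖⁻¹ ≤ Real.posLog (K⁻¹ * (n : ℝ) ^ |γ|) :=
          Real.posLog_le_posLog (by positivity) hinv
      _ ≤ Real.posLog K⁻¹ + Real.posLog ((n : ℝ) ^ |γ|) := Real.posLog_mul
      _ = Real.posLog K⁻¹ + |γ| * Real.log n := by
          rw [Real.posLog_eq_log (x := (n : ℝ) ^ |γ|), Real.log_rpow (by positivity)]
          exact (Real.one_le_rpow hn1 (abs_nonneg γ)).trans (le_abs_self _)
  refine hle.trans (.add ?_ ((Asymptotics.isBigO_refl _ _).const_mul_left _))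
  exact (Real.isLittleO_const_log_atTop.comp_tendsto tendsto_natCast_atTop_atTop).isBigO

/-- All moments of the sequence `|u 1|, |u 2|, …`, averaged over its first `n` terms, are bounded
uniformly in `n`. -/
def HasBoundedMoments (u : ℕ → ℝ) : Prop :=
  ∀ p : ℕ, ∃ C : ℝ, ∀ n : ℕ, ∑ m ∈ Finset.Icc 1 n, |u m| ^ p ≤ C * n

namespace HasBoundedMoments

variable {u v : ℕ → ℝ}

theorem mono (hv : HasBoundedMoments v) (huv : ∀ m, 1 ≤ m → |u m| ≤ |v m|) :
    HasBoundedMoments u := fun p => by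
  obtain ⟨C, hC⟩ := hv p
  refine ⟨C, fun n => (Finset.sum_le_sum fun m hm => ?_).trans (hC n)⟩
  exact pow_le_pow_left₀ (abs_nonneg _) (huv m (Finset.mem_Icc.mp hm).1) p

theorem const (c : ℝ) : HasBoundedMoments fun _ => c := fun p =>
  ⟨|c| ^ p, fun n => by
    rw [Finset.sum_const, Nat.card_Icc, add_tsub_cancel_right, nsmul_eq_mul, mul_comm]⟩

theorem add (hu : HasBoundedMoments u) (hv : HasBoundedMoments v) :
    HasBoundedMoments fun m => u m + v m := fun p => by
  obtain ⟨C, hC⟩ := hu p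
  obtain ⟨D, hD⟩ := hv p
  refine ⟨2 ^ (p - 1) * (C + D), fun n => ?_⟩
  calc ∑ m ∈ Finset.Icc 1 n, |u m + v m| ^ p
      ≤ ∑ m ∈ Finset.Icc 1 n, 2 ^ (p - 1) * (|u m| ^ p + |v m| ^ p) :=
        Finset.sum_le_sum fun m _ =>
          (pow_le_pow_left₀ (abs_nonneg _) (abs_add_le _ _) p).trans
            (add_pow_le (abs_nonneg _) (abs_nonneg _) p)
    _ ≤ 2 ^ (p - 1) * (C * n + D * n) := by
        rw [← Finset.mul_sum, Finset.sum_add_distrib]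
        gcongr
        exacts [hC n, hD n]
    _ = 2 ^ (p - 1) * (C + D) * n := by ring

theorem mul (hu : HasBoundedMoments u) (hv : HasBoundedMoments v) :
    HasBoundedMoments fun m => u m * v m := fun p => by
  obtain ⟨C, hC⟩ := hu (p * 2)
  obtain ⟨D, hD⟩ := hv (p * 2)
  refine ⟨C + D, fun n => ?_⟩
  calc ∑ m ∈ Finset.Icc 1 n, |u m * v m| ^ p
      ≤ ∑ m ∈ Finset.Icc 1 n, (|u m| ^ (p * 2) + |v m| ^ (p * 2)) :=
        Finset.sum_le_sum fun m _ => by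
          rw [abs_mul, mul_pow, pow_mul, pow_mul]
          nlinarith [two_mul_le_add_sq (|u m| ^ p) (|v m| ^ p),
            mul_nonneg (pow_nonneg (abs_nonneg (u m)) p) (pow_nonneg (abs_nonneg (v m)) p)]
    _ ≤ (C + D) * n := by
        rw [Finset.sum_add_distrib, add_mul]
        exact add_le_add (hC n) (hD n)

theorem sum {ι : Type*} {s : Finset ι} {u : ι → ℕ → ℝ} (h : ∀ i ∈ s, HasBoundedMoments (u i)) :
    HasBoundedMoments fun m => ∑ i ∈ s, u i m := by
  simpa only [Finset.sum_fn] using Finset.sum_induction u HasBoundedMoments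
    (fun _ _ => add) (const 0) h

theorem prod {ι : Type*} {s : Finset ι} {u : ι → ℕ → ℝ} (h : ∀ i ∈ s, HasBoundedMoments (u i)) :
    HasBoundedMoments fun m => ∏ i ∈ s, u i m := by
  simpa only [Finset.prod_fn] using Finset.prod_induction u HasBoundedMoments
    (fun _ _ => mul) (const 1) h

end HasBoundedMoments

theorem posLog_le_rpow_div {x : ℝ} (hx : 0 ≤ x) {ε : ℝ} (hε : 0 < ε) :
    Real.posLog x ≤ x ^ ε / ε :=
  max_le (by positivity) (Real.log_le_rpow_div hx hε)

theorem IsDiophantine.hasBoundedMoments_posLog_inv_norm (hθ : IsDiophantine θ 0)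
    (hθa : IsDiophantine θ a) : HasBoundedMoments fun m => Real.posLog ‖m • θ - a‖⁻¹ := by
  obtain ⟨s, C, hs, hC⟩ := hθ.exists_sum_inv_norm_rpow_le hθa
  rintro (_ | p)
  · simpa only [pow_zero] using HasBoundedMoments.const 1 0
  have hp : (0 : ℝ) < (p + 1 : ℕ) := by positivity
  refine ⟨C / (s / (p + 1 : ℕ)) ^ (p + 1), fun n => ?_⟩
  calc ∑ m ∈ Finset.Icc 1 n, |Real.posLog ‖m • θ - a‖⁻¹| ^ (p + 1)
      ≤ ∑ m ∈ Finset.Icc 1 n, ‖m • θ - a‖⁻¹ ^ s / (s / (p + 1 : ℕ)) ^ (p + 1) := by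
        refine Finset.sum_le_sum fun m _ => ?_
        have hle := posLog_le_rpow_div (inv_nonneg.mpr (norm_nonneg (m • θ - a))) (div_pos hs hp)
        refine (pow_le_pow_left₀ (abs_nonneg _)
          ((abs_of_nonneg Real.posLog_nonneg).trans_le hle) _).trans_eq ?_
        rw [div_pow, ← Real.rpow_mul_natCast (by positivity), div_mul_cancel₀ s hp.ne']
    _ ≤ C / (s / (p + 1 : ℕ)) ^ (p + 1) * n := by
        rw [← Finset.sum_div, div_mul_eq_mul_div]
        gcongr
        exact hC n

end Diophantine

section AnalyticOnAddCircle

variable {T : ℝ}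

theorem eventually_nhds_coe_iff {p : AddCircle T → Prop} {t : ℝ} :
    (∀ᶠ z in 𝓝 (t : AddCircle T), p z) ↔ ∀ᶠ s : ℝ in 𝓝 t, p s := by
  have hq : IsOpenQuotientMap ((↑) : ℝ → AddCircle T) := QuotientAddGroup.isOpenQuotientMap_mk
  rw [← hq.map_nhds_eq, eventually_map]

theorem eventually_cofinite_of_forall_eventually_nhdsNE [Fact (0 < T)] {p : AddCircle T → Prop}
    (h : ∀ t : ℝ, ∀ᶠ s : ℝ in 𝓝[≠] t, p s) : ∀ᶠ z in cofinite, p z := by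
  refine cofinite_le_codiscrete (mem_codiscrete.mpr fun z => ?_)
  induction z using QuotientAddGroup.induction_on with
  | H t =>
    rw [disjoint_principal_right, compl_compl]
    refine eventually_nhdsWithin_iff.mpr (eventually_nhds_coe_iff.mpr ?_)
    filter_upwards [eventually_nhdsWithin_iff.mp (h t)] with s hs hne
    exact hs (ne_of_apply_ne _ hne)

theorem eventually_cofinite_continuousAt [Fact (0 < T)] {Y : Type*} [TopologicalSpace Y]
    {G : AddCircle T → Y}
    (h : ∀ t : ℝ, ∀ᶠ s in 𝓝[≠] t, ContinuousAt (fun s : ℝ => G s) s) :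
    ∀ᶠ z in cofinite, ContinuousAt G z :=
  eventually_cofinite_of_forall_eventually_nhdsNE fun t => (h t).mono fun _ hs _ hu =>
    eventually_nhds_coe_iff.mpr (hs hu)

theorem eventually_continuousAt_log_norm {E : Type*} [NormedAddCommGroup E] [NormedSpace ℝ E]
    [CompleteSpace E] {f : ℝ → E} {t : ℝ} (hf : AnalyticAt ℝ f t) :
    ∀ᶠ s in 𝓝[≠] t, ContinuousAt (fun s => Real.log ‖f s‖) s := by
  rcases hf.eventually_eq_zero_or_eventually_ne_zero with h | h
  · filter_upwards [h.eventually_nhds.filter_mono nhdsWithin_le_nhds] with s hs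
    exact continuousAt_const.congr (hs.mono fun u hu => (congrArg (Real.log ‖·‖) hu).symm)
  · filter_upwards [h, hf.eventually_analyticAt.filter_mono nhdsWithin_le_nhds] with s hs hfs
    exact hfs.continuousAt.norm.log (norm_ne_zero_iff.mpr hs)

theorem eventually_continuousAt_arg {f : ℝ → ℂ} {t : ℝ} (hf : AnalyticAt ℝ f t) :
    ∀ᶠ s in 𝓝[≠] t, ContinuousAt (fun s => (f s).arg) s := by
  have hre : AnalyticAt ℝ (fun s => (f s).re) t := (Complex.reCLM.analyticAt _).comp hf
  have him : AnalyticAt ℝ (fun s => (f s).im) t := (Complex.imCLM.analyticAt _).comp hf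
  have hslit : ∀ᶠ s in 𝓝[≠] t, f s ∈ Complex.slitPlane →
      ContinuousAt (fun s => (f s).arg) s := by
    filter_upwards [hf.eventually_analyticAt.filter_mono nhdsWithin_le_nhds] with s hs hfs
    exact (Complex.continuousAt_arg hfs).comp hs.continuousAt
  rcases him.eventually_eq_zero_or_eventually_ne_zero with him0 | him0
  swap
  · filter_upwards [hslit, him0] with s hs him using hs (.inr him)
  rcases hre.eventually_eq_zero_or_eventually_ne_zero with hre0 | hre0
  · filter_upwards [(him0.and hre0).eventually_nhds.filter_mono nhdsWithin_le_nhds] with s hs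
    refine (continuousAt_const (y := Complex.arg 0)).congr (hs.mono fun u hu => ?_)
    exact congrArg Complex.arg (Complex.ext hu.2.symm hu.1.symm)
  · filter_upwards [hslit, hre0, him0.eventually_nhds.filter_mono nhdsWithin_le_nhds,
      hre.eventually_analyticAt.filter_mono nhdsWithin_le_nhds] with s hs hre hims hres
    rcases hre.lt_or_gt with hneg | hpos
    · refine (continuousAt_const (y := Real.pi)).congr ?_
      filter_upwards [hims, hres.continuousAt.eventually_lt_const hneg] with u him hre
      exact (Complex.arg_eq_pi_iff.mpr ⟨hre, him⟩).symm
    · exact hs (.inl hpos)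

variable {E : Type*} [NormedAddCommGroup E] [NormedSpace ℝ E] {F : AddCircle T → E}

theorem continuous_of_analyticOnNhd_coe (hF : AnalyticOnNhd ℝ (fun t : ℝ => F t) Set.univ) :
    Continuous F :=
  QuotientAddGroup.isOpenQuotientMap_mk.isQuotientMap.continuous_iff.mpr hF.continuous

theorem not_eventually_eq_zero_of_analyticOnNhd_coe
    (hF : AnalyticOnNhd ℝ (fun t : ℝ => F t) Set.univ) (hF0 : F ≠ 0) (t : ℝ) :
    ¬∀ᶠ s : ℝ in 𝓝 t, F s = 0 := by
  refine fun h => hF0 (funext fun z => ?_)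
  induction z using QuotientAddGroup.induction_on with
  | H s =>
    exact hF.eqOn_zero_of_preconnected_of_eventuallyEq_zero isPreconnected_univ
      (Set.mem_univ t) h (Set.mem_univ s)

theorem eventually_posLog_inv_norm_le [Fact (0 < T)]
    (hF : AnalyticOnNhd ℝ (fun t : ℝ => F t) Set.univ) (hF0 : F ≠ 0)
    (a : AddCircle T) : ∃ N : ℕ, (F a ≠ 0 → N = 0) ∧ ∃ C : ℝ,
      ∀ᶠ z in 𝓝 a, Real.posLog ‖F z‖⁻¹ ≤ C + N * Real.posLog ‖z - a‖⁻¹ := by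
  induction a using QuotientAddGroup.induction_on with | H t =>
  obtain ⟨n, g, hg, hg0, hFg⟩ :=
    (hF t (Set.mem_univ t)).exists_eventuallyEq_pow_smul_nonzero_iff.mpr
      (not_eventually_eq_zero_of_analyticOnNhd_coe hF hF0 t)
  have hgt : ‖g t‖ / 2 < ‖g t‖ := half_lt_self (norm_pos_iff.mpr hg0)
  have hT : 0 < T := Fact.out
  refine ⟨n, fun hFt => ?_, Real.posLog (‖g t‖ / 2)⁻¹, eventually_nhds_coe_iff.mpr ?_⟩
  · by_contra hn
    exact hFt (by rw [hFg.self_of_nhds, sub_self, zero_pow hn, zero_smul])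
  filter_upwards [hFg, hg.continuousAt.norm.eventually_const_lt hgt,
    Metric.closedBall_mem_nhds t (half_pos hT)] with s hs hgs hst
  have hnorm : ‖(s : AddCircle T) - t‖ = |s - t| := by
    rw [← AddCircle.coe_sub, AddCircle.norm_coe_eq_abs_iff T hT.ne', abs_of_pos hT]
    exact hst
  calc Real.posLog ‖F s‖⁻¹ = Real.posLog (‖g s‖⁻¹ * (|s - t|⁻¹) ^ n) := by
        rw [hs, norm_smul, norm_pow, Real.norm_eq_abs, mul_inv, inv_pow, mul_comm]
    _ ≤ Real.posLog ‖g s‖⁻¹ + Real.posLog ((|s - t|⁻¹) ^ n) := Real.posLog_mul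
    _ ≤ Real.posLog (‖g t‖ / 2)⁻¹ + n * Real.posLog ‖(s : AddCircle T) - t‖⁻¹ := by
        rw [Real.posLog_pow, hnorm]
        gcongr

theorem exists_posLog_inv_norm_le [Fact (0 < T)]
    (hF : AnalyticOnNhd ℝ (fun t : ℝ => F t) Set.univ) (hF0 : F ≠ 0) :
    ∃ Z : Finset (AddCircle T), (∀ a ∈ Z, F a = 0) ∧ ∃ C : ℝ, 0 ≤ C ∧ ∀ z,
      Real.posLog ‖F z‖⁻¹ ≤ C * (1 + ∑ a ∈ Z, Real.posLog ‖z - a‖⁻¹) := by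
  classical
  suffices h : ∃ Z : Finset (AddCircle T), (∀ a ∈ Z, F a = 0) ∧ ∃ C : ℝ, 0 ≤ C ∧
      ∀ z ∈ Set.univ, Real.posLog ‖F z‖⁻¹ ≤ C * (1 + ∑ a ∈ Z, Real.posLog ‖z - a‖⁻¹) by
    simpa only [Set.mem_univ, true_implies] using h
  refine isCompact_univ.induction_on ?_ ?_ ?_ fun a _ => ?_
  · exact ⟨∅, by simp, 0, le_rfl, by simp⟩
  · exact fun s s' hs ⟨Z, hZ, C, hC, h⟩ => ⟨Z, hZ, C, hC, fun z hz => h z (hs hz)⟩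
  · rintro s s' ⟨Z, hZ, C, hC, h⟩ ⟨Z', hZ', C', -, h'⟩
    refine ⟨Z ∪ Z', fun a ha => (Finset.mem_union.mp ha).elim (hZ a) (hZ' a), max C C',
      hC.trans (le_max_left _ _), fun z hz => ?_⟩
    have hnonneg (Y : Finset (AddCircle T)) : 0 ≤ ∑ a ∈ Y, Real.posLog ‖z - a‖⁻¹ :=
      Finset.sum_nonneg fun _ _ => Real.posLog_nonneg
    rcases hz with hz | hz
    · refine (h z hz).trans ?_
      have := hnonneg Z
      gcongr
      exacts [le_max_left _ _, fun _ _ _ => Real.posLog_nonneg, Finset.subset_union_left]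
    · refine (h' z hz).trans ?_
      have := hnonneg Z'
      gcongr
      exacts [le_max_right _ _, fun _ _ _ => Real.posLog_nonneg, Finset.subset_union_right]
  · obtain ⟨N, hN, C, hC⟩ := eventually_posLog_inv_norm_le hF hF0 a
    refine ⟨_, nhdsWithin_le_nhds hC, if F a = 0 then {a} else ∅, ?_, max C N,
      (Nat.cast_nonneg N).trans (le_max_right _ _), fun z hz => hz.trans ?_⟩
    · split_ifs <;> simp [*]
    have hpos : 0 ≤ Real.posLog ‖z - a‖⁻¹ := Real.posLog_nonneg
    split_ifs with ha
    · rw [Finset.sum_singleton, mul_add, mul_one]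
      gcongr
      exacts [le_max_left _ _, le_max_right _ _]
    · simp [hN ha]

theorem exists_abs_log_norm_le [Fact (0 < T)]
    (hF : AnalyticOnNhd ℝ (fun t : ℝ => F t) Set.univ) (hF0 : F ≠ 0) :
    ∃ Z : Finset (AddCircle T), (∀ a ∈ Z, F a = 0) ∧ ∃ C : ℝ, ∀ z,
      |Real.log ‖F z‖| ≤ C * (1 + ∑ a ∈ Z, Real.posLog ‖z - a‖⁻¹) := by
  obtain ⟨Z, hZ, C, -, hC⟩ := exists_posLog_inv_norm_le hF hF0
  obtain ⟨M, hM⟩ := isCompact_univ.exists_bound_of_continuousOn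
    (continuous_of_analyticOnNhd_coe hF).continuousOn
  refine ⟨Z, hZ, Real.posLog M + C, fun z => ?_⟩
  have hsum : 0 ≤ ∑ a ∈ Z, Real.posLog ‖z - a‖⁻¹ :=
    Finset.sum_nonneg fun _ _ => Real.posLog_nonneg
  calc |Real.log ‖F z‖| ≤ Real.posLog ‖F z‖ + Real.posLog ‖F z‖⁻¹ := by
        rw [← Real.posLog_sub_posLog_inv]
        exact (abs_sub _ _).trans_eq
          (by rw [abs_of_nonneg Real.posLog_nonneg, abs_of_nonneg Real.posLog_nonneg])
    _ ≤ Real.posLog M * (1 + ∑ a ∈ Z, Real.posLog ‖z - a‖⁻¹) +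
        C * (1 + ∑ a ∈ Z, Real.posLog ‖z - a‖⁻¹) := by
        refine add_le_add ?_ (hC z)
        exact (Real.posLog_le_posLog (norm_nonneg _) (hM z (Set.mem_univ z))).trans
          (le_mul_of_one_le_right Real.posLog_nonneg (by linarith))
    _ = (Real.posLog M + C) * (1 + ∑ a ∈ Z, Real.posLog ‖z - a‖⁻¹) := (add_mul _ _ _).symm

end AnalyticOnAddCircle

section Orbits

theorem map_nsmul_ne_zero {A B : Type*} [SeminormedAddCommGroup A] [Zero B] {θ : A} {F : A → B}
    (hz : ∀ a, F a = 0 → IsDiophantine θ a) {n : ℕ} (hn : 1 ≤ n) : F (n • θ) ≠ 0 :=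
  fun h => (hz _ h).nsmul_sub_ne_zero hn (sub_self _)

variable {T : ℝ} [Fact (0 < T)] {θ : AddCircle T}

instance nullSingletonClass_volume_addCircle :
    NullSingletonClass (volume : Measure (AddCircle T)) where
  measure_singleton z := by
    rw [← Metric.closedBall_zero, AddCircle.volume_closedBall, mul_zero,
      min_eq_right (Fact.out : 0 < T).le, ENNReal.ofReal_zero]

/-- A measurable function on a circle that is continuous off a finite set and whose values along
the positive multiples of `θ` have bounded moments: the hypothesis under which averages of `g`,
and of products of such functions, along the multiples of `θ` can be compared with integrals. -/
structure IsTameAlong (θ : AddCircle T) (g : AddCircle T → ℝ) : Prop where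
  measurable : Measurable g
  eventually_continuousAt : ∀ᶠ z in cofinite, ContinuousAt g z
  hasBoundedMoments : HasBoundedMoments fun m => g (m • θ)

theorem integrable_and_tendsto_average_prod {ι : Type*} [Fintype ι] {θ : UnitAddTorus ι}
    (hθ : LinearIndependent ℤ θ) {g : ι → UnitAddCircle → ℝ} (hg : ∀ i, IsTameAlong (θ i) (g i)) :
    Integrable (fun z : UnitAddTorus ι => ∏ i, g i (z i)) ∧
    Tendsto (fun n : ℕ => (n : ℝ)⁻¹ * ∑ m ∈ Finset.Icc 1 n, ∏ i, g i (m • θ i)) atTop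
      (𝓝 (∫ z : UnitAddTorus ι, ∏ i, g i (z i))) := by
  obtain ⟨C, hC⟩ := HasBoundedMoments.prod (s := Finset.univ)
    (fun i _ => (hg i).hasBoundedMoments) 2
  simp only [sq_abs] at hC
  refine integrable_and_tendsto_average_of_tendsto_empiricalMeasure
    (tendsto_empiricalMeasure_nsmul hθ)
    (Finset.measurable_fun_prod _ fun i _ => (hg i).measurable.comp (measurable_pi_apply i)) ?_ hC
  have hcont (i : ι) : ∀ᵐ z : UnitAddTorus ι, ContinuousAt (g i) (z i) :=
    Measure.tendsto_eval_ae_ae.eventually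
      (ae_iff.mpr (Set.Finite.measure_zero (hg i).eventually_continuousAt volume))
  filter_upwards [ae_all_iff.mpr hcont] with z hz
  exact tendsto_finsetProd _ fun i _ => (hz i).tendsto.comp (continuous_apply i).continuousAt

section Analytic

variable {E : Type*} [NormedAddCommGroup E] [NormedSpace ℝ E] {F : AddCircle T → E}

theorem isBigO_log_norm_map_nsmul (hF : AnalyticOnNhd ℝ (fun t : ℝ => F t) Set.univ)
    (hz : ∀ a, F a = 0 → IsDiophantine θ a) :
    (fun n : ℕ => Real.log ‖F (n • θ)‖) =O[atTop] fun n : ℕ => Real.log n := by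
  have hF0 : F ≠ 0 := fun h => map_nsmul_ne_zero hz le_rfl (congrFun h _)
  obtain ⟨Z, hZ, C, hC⟩ := exists_abs_log_norm_le hF hF0
  have hconst : (fun _ : ℕ => (1 : ℝ)) =O[atTop] fun n : ℕ => Real.log n :=
    (Real.isLittleO_const_log_atTop.comp_tendsto tendsto_natCast_atTop_atTop).isBigO
  refine (Asymptotics.IsBigO.of_norm_le fun n => hC (n • θ)).trans ?_
  refine (hconst.add ?_).const_mul_left C
  exact .fun_sum fun a ha => (hz a (hZ a ha)).isBigO_posLog_inv_norm

theorem isTameAlong_log_norm [CompleteSpace E]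
    (hF : AnalyticOnNhd ℝ (fun t : ℝ => F t) Set.univ) (hθ : IsDiophantine θ 0)
    (hz : ∀ a, F a = 0 → IsDiophantine θ a) : IsTameAlong θ fun z => Real.log ‖F z‖ where
  measurable := (continuous_of_analyticOnNhd_coe hF).norm.measurable.log
  eventually_continuousAt := eventually_cofinite_continuousAt fun t =>
    eventually_continuousAt_log_norm (hF t (Set.mem_univ t))
  hasBoundedMoments := by
    have hF0 : F ≠ 0 := fun h => map_nsmul_ne_zero hz le_rfl (congrFun h _)
    obtain ⟨Z, hZ, C, hC⟩ := exists_abs_log_norm_le hF hF0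
    have hsum : HasBoundedMoments fun m => ∑ a ∈ Z, Real.posLog ‖m • θ - a‖⁻¹ :=
      .sum fun a ha => hθ.hasBoundedMoments_posLog_inv_norm (hz a (hZ a ha))
    exact .mono (.mul (.const C) (.add (.const 1) hsum)) fun m _ =>
      (hC (m • θ)).trans (le_abs_self _)

theorem isTameAlong_arg {F : AddCircle T → ℂ}
    (hF : AnalyticOnNhd ℝ (fun t : ℝ => F t) Set.univ) : IsTameAlong θ fun z => (F z).arg where
  measurable := Complex.measurable_arg.comp (continuous_of_analyticOnNhd_coe hF).measurable
  eventually_continuousAt := eventually_cofinite_continuousAt fun t =>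
    eventually_continuousAt_arg (hF t (Set.mem_univ t))
  hasBoundedMoments := .mono (.const Real.pi) fun _ _ =>
    (Complex.abs_arg_le_pi _).trans (le_abs_self _)

end Analytic

end Orbits

section UnitExp

theorem unitExp_eq_toCircle (t : ℝ) : unitExp t = AddCircle.toCircle (t : UnitAddCircle) := by
  rw [AddCircle.toCircle_apply_mk, div_one, unitExp]

theorem unitExp_pow (t : ℝ) (m : ℕ) :
    unitExp t ^ m = AddCircle.toCircle (m • (t : UnitAddCircle)) := by
  rw [unitExp_eq_toCircle, AddCircle.toCircle_nsmul]

theorem distToInt_eq_norm_coe (t : ℝ) : distToInt t = ‖(t : UnitAddCircle)‖ := by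
  rw [UnitAddCircle.norm_eq]
  have hbdd : BddBelow (Set.range fun n : ℤ => |t - n|) :=
    ⟨0, Set.forall_mem_range.mpr fun n => abs_nonneg _⟩
  exact le_antisymm (ciInf_le hbdd (round t)) (le_ciInf (round_le t))

theorem measurePreserving_unitSquare :
    MeasurePreserving (fun p : ℝ × ℝ => (![↑p.1, ↑p.2] : UnitAddTorus (Fin 2)))
      (volume.restrict unitSquare) := by
  have hmk : MeasurePreserving (fun t : ℝ => (t : UnitAddCircle))
      (volume.restrict (Set.Icc 0 1)) := by
    simpa only [zero_add, restrict_Ioc_eq_restrict_Icc] using UnitAddCircle.measurePreserving_mk 0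
  rw [unitSquare, Measure.volume_eq_prod, ← Measure.prod_restrict]
  exact ((volume_preserving_finTwoArrow UnitAddCircle).symm _).comp (hmk.prod hmk)

theorem averageConvergesToIntegral_of_isTameAlong {g₁ g₂ : Circle → ℝ} {φ₁ φ₂ : ℝ}
    (hφ : LinearIndependent ℤ ![(φ₁ : UnitAddCircle), (φ₂ : UnitAddCircle)])
    (h₁ : IsTameAlong (φ₁ : UnitAddCircle) fun z => g₁ z.toCircle)
    (h₂ : IsTameAlong (φ₂ : UnitAddCircle) fun z => g₂ z.toCircle) :
    AverageConvergesToIntegral g₁ g₂ (unitExp φ₁) (unitExp φ₂) := by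
  obtain ⟨hint, hlim⟩ := integrable_and_tendsto_average_prod hφ
    (g := ![fun z => g₁ z.toCircle, fun z => g₂ z.toCircle]) (Fin.forall_fin_two.mpr ⟨h₁, h₂⟩)
  have hmp := measurePreserving_unitSquare
  have hprod (p : ℝ × ℝ) : ∏ i, (![fun z => g₁ z.toCircle, fun z => g₂ z.toCircle] : Fin 2 → _) i
      ((![↑p.1, ↑p.2] : UnitAddTorus (Fin 2)) i) = g₁ (unitExp p.1) * g₂ (unitExp p.2) := by
    simp [Fin.prod_univ_two, unitExp_eq_toCircle]
  refine ⟨?_, ?_⟩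
  · simpa only [IntegrableOn, Function.comp_def, hprod] using hmp.integrable_comp_of_integrable hint
  · rw [← hmp.map_eq, integral_map hmp.aemeasurable
      (hmp.map_eq.symm ▸ hint.aestronglyMeasurable)] at hlim
    simp only [hprod] at hlim
    simpa [Fin.prod_univ_two, unitExp_pow] using hlim

theorem isFiniteType_iff_norm {d : ℕ} {φ : Fin d → ℝ} :
    IsFiniteType φ ↔ ∃ K γ : ℝ, 0 < K ∧ 1 ≤ γ ∧ ∀ q : Fin d → ℤ, q ≠ 0 →
      K / ‖q‖ ^ γ ≤ ‖∑ j, q j • (φ j : UnitAddCircle)‖ := by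
  have hcoe (q : Fin d → ℤ) :
      ((∑ j, (q j : ℝ) * φ j : ℝ) : UnitAddCircle) = ∑ j, q j • (φ j : UnitAddCircle) := by
    simp only [← zsmul_eq_mul, ← AddCircle.coe_zsmul]
    exact map_sum (QuotientAddGroup.mk' _) _ _
  simp only [IsFiniteType, distToInt_eq_norm_coe, hcoe]

theorem IsFiniteType.linearIndependent {d : ℕ} {φ : Fin d → ℝ} (h : IsFiniteType φ) :
    LinearIndependent ℤ fun j => (φ j : UnitAddCircle) := by
  obtain ⟨K, γ, hK, -, h⟩ := isFiniteType_iff_norm.mp h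
  refine Fintype.linearIndependent_iff.mpr fun q hq => congrFun (?_ : q = 0)
  by_contra hq0
  have hpos : 0 < K / ‖q‖ ^ γ := div_pos hK (Real.rpow_pos_of_pos (norm_pos_iff.mpr hq0) γ)
  exact (hpos.trans_le (h q hq0)).ne' (by rw [hq, norm_zero])

theorem IsFiniteType.isDiophantine {d : ℕ} {φ : Fin d → ℝ} (h : IsFiniteType φ) (j : Fin d) :
    IsDiophantine (φ j : UnitAddCircle) 0 := by
  obtain ⟨K, γ, hK, -, h⟩ := isFiniteType_iff_norm.mp h
  refine ⟨K, γ, hK, fun n hn => ?_⟩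
  have hn0 : (n : ℤ) ≠ 0 := by lia
  have hsum : ∑ i, (Pi.single j n : Fin d → ℤ) i • (φ i : UnitAddCircle) =
      n • (φ j : UnitAddCircle) := by
    rw [Finset.sum_eq_single j (fun i _ hij => by rw [Pi.single_eq_of_ne hij, zero_smul])
      (fun hj => (hj (Finset.mem_univ j)).elim), Pi.single_eq_same, natCast_zsmul]
  simpa only [hsum, Pi.norm_single, Int.norm_natCast, sub_zero] using
    h (Pi.single j n) (Pi.single_ne_zero_iff.mpr hn0)

theorem ZerosAreRootsOfUnity.isDiophantine {f : Circle → ℂ} (hf : ZerosAreRootsOfUnity f)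
    {θ : UnitAddCircle} (hθ : IsDiophantine θ 0) (a : UnitAddCircle) (ha : f a.toCircle = 0) :
    IsDiophantine θ a := by
  obtain ⟨k, hk, hak⟩ := hf _ ha
  refine isDiophantine_of_nsmul_eq_zero hθ hk (AddCircle.injective_toCircle one_ne_zero ?_)
  rw [AddCircle.toCircle_nsmul, hak, AddCircle.toCircle_zero]

theorem IsRealAnalyticOnCircle.comp_toCircle {f : Circle → ℂ} (hf : IsRealAnalyticOnCircle f) :
    AnalyticOnNhd ℝ (fun t : ℝ => f (AddCircle.toCircle (t : UnitAddCircle))) Set.univ := by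
  simpa only [IsRealAnalyticOnCircle, unitExp_eq_toCircle] using hf

end UnitExp

theorem mainTheorem9_general {f₁ f₂ : Circle → ℂ} {φ₁ φ₂ : ℝ}
    (hf₁ : IsRealAnalyticOnCircle f₁) (hf₂ : IsRealAnalyticOnCircle f₂)
    (hφ₁ : IsDiophantine (φ₁ : UnitAddCircle) 0) (hφ₂ : IsDiophantine (φ₂ : UnitAddCircle) 0)
    (hz₁ : ∀ a : UnitAddCircle, f₁ a.toCircle = 0 → IsDiophantine (φ₁ : UnitAddCircle) a)
    (hz₂ : ∀ a : UnitAddCircle, f₂ a.toCircle = 0 → IsDiophantine (φ₂ : UnitAddCircle) a)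
    (hφ : LinearIndependent ℤ ![(φ₁ : UnitAddCircle), (φ₂ : UnitAddCircle)]) :
    (∀ n : ℕ, 1 ≤ n → f₁ (unitExp φ₁ ^ n) ≠ 0 ∧ f₂ (unitExp φ₂ ^ n) ≠ 0) ∧
    (fun n : ℕ => Real.log ‖f₁ (unitExp φ₁ ^ n)‖) =O[atTop] (fun n : ℕ => Real.log (n : ℝ)) ∧
    (fun n : ℕ => Real.log ‖f₂ (unitExp φ₂ ^ n)‖) =O[atTop] (fun n : ℕ => Real.log (n : ℝ)) ∧
    AverageConvergesToIntegral (fun z => Real.log ‖f₁ z‖) (fun z => Real.log ‖f₂ z‖)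
      (unitExp φ₁) (unitExp φ₂) ∧
    AverageConvergesToIntegral (fun z => Complex.arg (f₁ z)) (fun z => Real.log ‖f₂ z‖)
      (unitExp φ₁) (unitExp φ₂) ∧
    AverageConvergesToIntegral (fun z => Real.log ‖f₁ z‖) (fun z => Complex.arg (f₂ z))
      (unitExp φ₁) (unitExp φ₂) ∧
    AverageConvergesToIntegral (fun z => Complex.arg (f₁ z)) (fun z => Complex.arg (f₂ z))
      (unitExp φ₁) (unitExp φ₂) := by
  have hlog₁ : IsTameAlong (φ₁ : UnitAddCircle) fun z => Real.log ‖f₁ z.toCircle‖ :=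
    isTameAlong_log_norm hf₁.comp_toCircle hφ₁ hz₁
  have hlog₂ : IsTameAlong (φ₂ : UnitAddCircle) fun z => Real.log ‖f₂ z.toCircle‖ :=
    isTameAlong_log_norm hf₂.comp_toCircle hφ₂ hz₂
  have harg₁ : IsTameAlong (φ₁ : UnitAddCircle) fun z => (f₁ z.toCircle).arg :=
    isTameAlong_arg hf₁.comp_toCircle
  have harg₂ : IsTameAlong (φ₂ : UnitAddCircle) fun z => (f₂ z.toCircle).arg :=
    isTameAlong_arg hf₂.comp_toCircle
  simp only [unitExp_pow]
  exact ⟨fun n hn => ⟨map_nsmul_ne_zero hz₁ hn, map_nsmul_ne_zero hz₂ hn⟩,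
    isBigO_log_norm_map_nsmul hf₁.comp_toCircle hz₁,
    isBigO_log_norm_map_nsmul hf₂.comp_toCircle hz₂,
    averageConvergesToIntegral_of_isTameAlong hφ hlog₁ hlog₂,
    averageConvergesToIntegral_of_isTameAlong hφ harg₁ hlog₂,
    averageConvergesToIntegral_of_isTameAlong hφ hlog₁ harg₂,
    averageConvergesToIntegral_of_isTameAlong hφ harg₁ harg₂⟩

theorem mainTheorem9 (f₁ f₂ : Circle → ℂ) (φ₁ φ₂ : ℝ) (x₁ x₂ : Circle)
    (hf₁ : IsRealAnalyticOnCircle f₁) (hf₂ : IsRealAnalyticOnCircle f₂)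
    (hz₁ : ZerosAreRootsOfUnity f₁) (hz₂ : ZerosAreRootsOfUnity f₂)
    (hx₁ : x₁ = unitExp φ₁) (hx₂ : x₂ = unitExp φ₂)
    (hφ : IsFiniteType ![φ₁, φ₂]) :
    (∀ n : ℕ, 1 ≤ n → f₁ (x₁ ^ n) ≠ 0 ∧ f₂ (x₂ ^ n) ≠ 0) ∧
    (fun n : ℕ => Real.log ‖f₁ (x₁ ^ n)‖) =O[atTop] (fun n : ℕ => Real.log (n : ℝ)) ∧
    (fun n : ℕ => Real.log ‖f₂ (x₂ ^ n)‖) =O[atTop] (fun n : ℕ => Real.log (n : ℝ)) ∧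
    AverageConvergesToIntegral
      (fun z => Real.log ‖f₁ z‖) (fun z => Real.log ‖f₂ z‖) x₁ x₂ ∧
    AverageConvergesToIntegral
      (fun z => Complex.arg (f₁ z)) (fun z => Real.log ‖f₂ z‖) x₁ x₂ ∧
    AverageConvergesToIntegral
      (fun z => Real.log ‖f₁ z‖) (fun z => Complex.arg (f₂ z)) x₁ x₂ ∧
    AverageConvergesToIntegral
      (fun z => Complex.arg (f₁ z)) (fun z => Complex.arg (f₂ z)) x₁ x₂ := by
  subst hx₁ hx₂
  have hφ₁ : IsDiophantine (φ₁ : UnitAddCircle) 0 := hφ.isDiophantine 0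
  have hφ₂ : IsDiophantine (φ₂ : UnitAddCircle) 0 := hφ.isDiophantine 1
  refine mainTheorem9_general hf₁ hf₂ hφ₁ hφ₂ (hz₁.isDiophantine hφ₁) (hz₂.isDiophantine hφ₂) ?_
  convert hφ.linearIndependent using 1
  exact funext (Fin.forall_fin_two.mpr ⟨rfl, rfl⟩)
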